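/- Let $c_1,c_2,\lambda>0$. Let $\{N(t)\}_{t\ge0}$ be a homogeneous Poisson process with rate $\lambda$, and let $V(0)$ be a random variable independent of $\{N(t)\}_{t\ge0}$ with $P\{V(0)=c_1\}=P\{V(0)=-c_2\}=\tfrac12$. Let $V(t)$ be the velocity that starts from $V(0)$ and switches between the values $c_1$ and $-c_2$ at every event of $N$, and let $\mathcal T(t)=\int_0^t V(s)\,ds$, $t\ge0$, be the asymmetric telegraph process. Then for every $t>0$, every integer $k\ge1$ and every $\beta\in[0,c_1t]$, $$P\Big\{\max_{0\le s\le t}\mathcal T(s)<\beta\ \Big|\ V(0)=c_1,\ N(t)=2k\Big\}=\frac{1}{[(c_1+c_2)t]^{2k}}\sum_{j=0}^{k-1}\binom{2k}{j}\Big[(c_1t-\beta)^j(c_2t+\beta)^{2k-j}-\Big(\frac{c_2}{c_1}\Big)^{2k-2j}(c_1t-\beta)^{2k-j}(c_2t+\beta)^j\Big].$$ -/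

import Mathlib

open MeasureTheory ProbabilityTheory Set
open scoped NNReal ENNReal

noncomputable section

/-- `N` is a homogeneous Poisson process with rate `lam` under `μ`: an `ℕ`-valued process started
at `0`, with nondecreasing right-continuous paths, independent increments, and increments over
`(s, t]` that are Poisson distributed with parameter `lam * (t - s)`. The paths being almost surely
nondecreasing, the truncated differences of naturals below are almost surely true differences. -/
structure IsPoissonProcess {Ω : Type*} [MeasurableSpace Ω] (lam : ℝ≥0) (N : ℝ≥0 → Ω → ℕ)
    (μ : Measure Ω) : Prop where
  measurable : ∀ t, Measurable (N t)
  start : ∀ᵐ ω ∂μ, N 0 ω = 0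
  monotone : ∀ᵐ ω ∂μ, Monotone fun t => N t ω
  rightContinuous : ∀ᵐ ω ∂μ, ∀ t, ContinuousWithinAt (fun s => N s ω) (Ici t) t
  indepIncrements : HasIndepIncrements N μ
  lawIncrements : ∀ s t, s ≤ t →
    μ.map (fun ω => N t ω - N s ω) = poissonMeasure (lam * (t - s))

/-- The random inputs of the asymmetric telegraph process: a homogeneous Poisson process `N` with
rate `lam`, and an initial velocity `V₀`, equal to `c₁` or `-c₂` with probability `1/2` each and
independent of the whole process `N`. -/
structure IsTelegraphInput {Ω : Type*} [MeasurableSpace Ω] (c₁ c₂ : ℝ) (lam : ℝ≥0)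
    (V₀ : Ω → ℝ) (N : ℝ≥0 → Ω → ℕ) (μ : Measure Ω) : Prop where
  poisson : IsPoissonProcess lam N μ
  measurable_init : Measurable V₀
  law_init : μ.map V₀ =
    (2⁻¹ : ℝ≥0∞) • Measure.dirac c₁ + (2⁻¹ : ℝ≥0∞) • Measure.dirac (-c₂)
  indep_init : IndepFun V₀ (fun ω t => N t ω) μ

/-- The velocity `V(s)`: it starts from `V₀` and switches between `c₁` and `-c₂` at every event
counted by `N`. -/
def telegraphVelocity {Ω : Type*} (c₁ c₂ : ℝ) (V₀ : Ω → ℝ) (N : ℝ≥0 → Ω → ℕ) (s : ℝ≥0)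
    (ω : Ω) : ℝ :=
  if Even (N s ω) then V₀ ω else if V₀ ω = c₁ then -c₂ else c₁

/-- The asymmetric telegraph process `𝒯(t) = ∫₀ᵗ V(s) ds`, the position at time `t` of the particle
started from the origin. -/
def telegraph {Ω : Type*} (c₁ c₂ : ℝ) (V₀ : Ω → ℝ) (N : ℝ≥0 → Ω → ℕ) (t : ℝ≥0) (ω : Ω) : ℝ :=
  ∫ s in (0 : ℝ)..(t : ℝ), telegraphVelocity c₁ c₂ V₀ N s.toNNReal ω

/-- The running maximum `max_{0 ≤ s ≤ t} 𝒯(s)` (attained, by `isGreatest_telegraphMax`). -/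
def telegraphMax {Ω : Type*} (c₁ c₂ : ℝ) (V₀ : Ω → ℝ) (N : ℝ≥0 → Ω → ℕ) (t : ℝ≥0) (ω : Ω) : ℝ :=
  sSup ((fun s => telegraph c₁ c₂ V₀ N s ω) '' Icc 0 t)

/-- On every nondecreasing path of `N` the velocity is integrable, the position is continuous and
the supremum in `telegraphMax` is a maximum. -/
theorem isGreatest_telegraphMax {Ω : Type*} (c₁ c₂ : ℝ) (V₀ : Ω → ℝ) (N : ℝ≥0 → Ω → ℕ) (t : ℝ≥0)
    (ω : Ω) (hN : Monotone fun s => N s ω) :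
    IsGreatest ((fun s => telegraph c₁ c₂ V₀ N s ω) '' Icc 0 t)
      (telegraphMax c₁ c₂ V₀ N t ω) := by
  have hmeas : Measurable fun s : ℝ => telegraphVelocity c₁ c₂ V₀ N s.toNNReal ω := by
    have h1 : Measurable fun s : ℝ => N s.toNNReal ω :=
      hN.measurable.comp measurable_real_toNNReal
    exact (measurable_from_nat (f := fun n =>
      if Even n then V₀ ω else if V₀ ω = c₁ then -c₂ else c₁)).comp h1
  have hint : ∀ a b : ℝ, IntervalIntegrable
      (fun s : ℝ => telegraphVelocity c₁ c₂ V₀ N s.toNNReal ω) volume a b := by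
    intro a b
    refine (intervalIntegrable_const (c := |V₀ ω| + |c₁| + |c₂|)).mono_fun
      hmeas.aestronglyMeasurable (Filter.Eventually.of_forall fun s => ?_)
    have h1 := abs_nonneg (V₀ ω)
    have h2 := abs_nonneg c₁
    have h3 := abs_nonneg c₂
    simp only [telegraphVelocity, Real.norm_eq_abs]
    rw [abs_of_nonneg (by positivity : 0 ≤ |V₀ ω| + |c₁| + |c₂|)]
    split_ifs <;> (try rw [abs_neg]) <;> linarith
  have hcont : Continuous fun s : ℝ≥0 => telegraph c₁ c₂ V₀ N s ω :=
    (intervalIntegral.continuous_primitive hint 0).comp NNReal.continuous_coe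
  exact (isCompact_Icc.image hcont).isGreatest_sSup ⟨_, 0, ⟨le_rfl, zero_le⟩, rfl⟩

end

/-! Given `V(0) = c₁` and `N(t) = n`, the jump times are uniform on the simplex of ordered times in
`(0, t)` (`IsTelegraphInput.map_jumpTime`). A path is affine between switches, so its maximum is
below `β` exactly when its positions at the switches and at time `t` are
(`forall_lt_iff_staysBelow`). The probability is therefore the volume of such switching times
divided by `t ^ n / n!`.

The volume comes from integrating over the first switch. For a particle at `p` at time `s`, put `x =
(c₁(t-s) - (β-p))/(c₁+c₂)`, `y = (c₂(t-s) + (β-p))/(c₁+c₂)`, `r = c₂/c₁`. Rising keeps `x` fixed and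
lowers `y` at unit speed; falling keeps `y` fixed and lowers `x` at unit speed. The recursion
becomes `∂upVol (k+1)/∂y = downVol k` and `∂downVol k/∂x = upVol k`. The boundary conditions are
`upVol = 0` on `y = r x` (the particle is at the level) and `downVol = y ^ (2k+1) / (2k+1)!` at `x =
0` (the level is practically out of reach). The subtracted sum plays the part of a reflection term,
making `upVol` vanish on that line. The induction is `volume_staysBelow_up` with
`volume_staysBelow_down`. -/

/-! ### Divided powers and the two volume polynomials -/

/-- The divided power `x ^ n / n!`. -/
noncomputable def divPow (n : ℕ) (x : ℝ) : ℝ := x ^ n / (n.factorial : ℝ)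

theorem divPow_zero_left (x : ℝ) : divPow 0 x = 1 := by simp [divPow]

theorem divPow_succ_zero (n : ℕ) : divPow (n + 1) 0 = 0 := by simp [divPow]

theorem divPow_nonneg {n : ℕ} {x : ℝ} (hx : 0 ≤ x) : 0 ≤ divPow n x := by
  unfold divPow; positivity

theorem divPow_smul (n : ℕ) (c x : ℝ) : divPow n (c * x) = c ^ n * divPow n x := by
  simp only [divPow, mul_pow, mul_div_assoc]

theorem hasDerivAt_divPow (n : ℕ) (x : ℝ) : HasDerivAt (divPow (n + 1)) (divPow n x) x := by
  have h := (hasDerivAt_pow (n + 1) x).div_const ((n + 1).factorial : ℝ)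
  refine h.congr_deriv ?_
  simp only [divPow, Nat.factorial_succ, Nat.add_sub_cancel]
  have := Nat.factorial_ne_zero n
  push_cast
  field_simp

theorem continuous_divPow (n : ℕ) : Continuous (divPow n) := by
  unfold divPow; fun_prop

/-- The volume of the switching times keeping the rising particle below the level, in
the coordinates that are constant along falling and rising segments respectively. -/
noncomputable def upVol (r : ℝ) (k : ℕ) (x y : ℝ) : ℝ :=
  ∑ j ∈ Finset.range k, (divPow j x * divPow (2 * k - j) y
    - r ^ (2 * k - 2 * j) * (divPow (2 * k - j) x * divPow j y))

/-- The analogue of `upVol` for the falling particle. -/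
noncomputable def downVol (r : ℝ) (k : ℕ) (x y : ℝ) : ℝ :=
  ∑ j ∈ Finset.range (k + 1), divPow j x * divPow (2 * k + 1 - j) y
    - ∑ j ∈ Finset.range k, r ^ (2 * k - 2 * j) * (divPow (2 * k + 1 - j) x * divPow j y)

/-- The recursion for a rising particle: delaying its first switch lowers `y` only. -/
theorem hasDerivAt_upVol (r : ℝ) (k : ℕ) (x y : ℝ) :
    HasDerivAt (fun y => upVol r (k + 1) x y) (downVol r k x y) y := by
  have h1 : ∀ j ∈ Finset.range (k + 1), HasDerivAt
      (fun y => divPow j x * divPow (2 * (k + 1) - j) y)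
      (divPow j x * divPow (2 * k + 1 - j) y) y := by
    intro j hj
    have : 2 * (k + 1) - j = 2 * k + 1 - j + 1 := by have := Finset.mem_range.1 hj; omega
    rw [this]
    exact (hasDerivAt_divPow _ y).const_mul _
  have h2 : ∀ j ∈ Finset.range k, HasDerivAt
      (fun y => r ^ (2 * (k + 1) - 2 * (j + 1)) *
        (divPow (2 * (k + 1) - (j + 1)) x * divPow (j + 1) y))
      (r ^ (2 * k - 2 * j) * (divPow (2 * k + 1 - j) x * divPow j y)) y := by
    intro j hj
    have e1 : 2 * (k + 1) - 2 * (j + 1) = 2 * k - 2 * j := by omega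
    have e2 : 2 * (k + 1) - (j + 1) = 2 * k + 1 - j := by omega
    rw [e1, e2]
    exact ((hasDerivAt_divPow _ y).const_mul _).const_mul _
  -- The constant in `y` is the subtracted term with `j = 0`; the other subtracted terms are shifted
  -- by one in `h2`.
  have h := ((HasDerivAt.fun_sum h1).sub (HasDerivAt.fun_sum h2)).sub_const
    (r ^ (2 * (k + 1)) * divPow (2 * (k + 1)) x)
  refine h.congr_of_eventuallyEq (Filter.Eventually.of_forall fun z => ?_)
  simp only [upVol, Finset.sum_sub_distrib, Pi.sub_apply]
  rw [Finset.sum_range_succ' (fun j => r ^ (2 * (k + 1) - 2 * j) *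
        (divPow (2 * (k + 1) - j) x * divPow j z)) k]
  simp [divPow_zero_left]
  ring

theorem hasDerivAt_downVol (r : ℝ) (k : ℕ) (x y : ℝ) :
    HasDerivAt (fun x => downVol r k x y) (upVol r k x y) x := by
  have h1 : ∀ j ∈ Finset.range k, HasDerivAt
      (fun x => divPow (j + 1) x * divPow (2 * k + 1 - (j + 1)) y)
      (divPow j x * divPow (2 * k - j) y) x := by
    intro j hj
    have : 2 * k + 1 - (j + 1) = 2 * k - j := by omega
    rw [this]
    exact (hasDerivAt_divPow _ x).mul_const _
  have h2 : ∀ j ∈ Finset.range k, HasDerivAt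
      (fun x => r ^ (2 * k - 2 * j) * (divPow (2 * k + 1 - j) x * divPow j y))
      (r ^ (2 * k - 2 * j) * (divPow (2 * k - j) x * divPow j y)) x := by
    intro j hj
    have : 2 * k + 1 - j = 2 * k - j + 1 := by have := Finset.mem_range.1 hj; omega
    rw [this]
    exact ((hasDerivAt_divPow _ x).mul_const _).const_mul _
  have h := ((HasDerivAt.fun_sum h1).sub (HasDerivAt.fun_sum h2)).add_const
    (divPow (2 * k + 1) y)
  have h' := h.congr_deriv (g' := upVol r k x y)
    (by simp only [upVol, Finset.sum_sub_distrib])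
  refine h'.congr_of_eventuallyEq (Filter.Eventually.of_forall fun z => ?_)
  simp only [downVol, Pi.sub_apply]
  rw [Finset.sum_range_succ' (fun j => divPow j z * divPow (2 * k + 1 - j) y) k]
  simp [divPow_zero_left]
  ring

/-- Each summand cancels by itself, both products being `r ^ (2k-j)` times the same divided powers
of `x`. The line `y = r x` corresponds to `p = β`. -/
theorem upVol_diag (r : ℝ) (k : ℕ) (x : ℝ) : upVol r k x (r * x) = 0 := by
  refine Finset.sum_eq_zero fun j hj => ?_
  have e : r ^ (2 * k - j) = r ^ (2 * k - 2 * j) * r ^ j := by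
    rw [← pow_add]; congr 1; have := Finset.mem_range.1 hj; omega
  rw [divPow_smul, divPow_smul, e]
  ring

/-- After factoring out `x ^ j * y ^ j`, each summand compares `(r x) ^ (2k-2j)` with `y ^ (2k-2j)`.
-/
theorem upVol_nonneg {r x y : ℝ} (hr : 0 ≤ r) (hx : 0 ≤ x) (hy : r * x ≤ y) (k : ℕ) :
    0 ≤ upVol r k x y := by
  refine Finset.sum_nonneg fun j hj => ?_
  have e : ∀ z : ℝ, z ^ (2 * k - j) = z ^ (2 * k - 2 * j) * z ^ j := fun z => by
    rw [← pow_add]; congr 1; have := Finset.mem_range.1 hj; omega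
  have hrx : 0 ≤ r * x := mul_nonneg hr hx
  have hp : (r * x) ^ (2 * k - 2 * j) ≤ y ^ (2 * k - 2 * j) := pow_le_pow_left₀ hrx hy _
  have h0 : (0 : ℝ) ≤ x ^ j * y ^ j / (j.factorial * (2 * k - j).factorial) := by
    have := hrx.trans hy
    positivity
  have := mul_le_mul_of_nonneg_right hp h0
  have e1 : divPow j x * divPow (2 * k - j) y =
      y ^ (2 * k - 2 * j) * (x ^ j * y ^ j / (j.factorial * (2 * k - j).factorial)) := by
    simp only [divPow]
    rw [div_mul_div_comm]
    rw [e]; ring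
  have e2 : r ^ (2 * k - 2 * j) * (divPow (2 * k - j) x * divPow j y) =
      (r * x) ^ (2 * k - 2 * j) * (x ^ j * y ^ j / (j.factorial * (2 * k - j).factorial)) := by
    simp only [divPow]
    rw [div_mul_div_comm]
    rw [e, mul_pow]; ring
  rw [e1, e2]
  linarith

theorem downVol_zero_left (r : ℝ) (k : ℕ) (y : ℝ) : downVol r k 0 y = divPow (2 * k + 1) y := by
  unfold downVol
  rw [Finset.sum_range_succ' (fun j => divPow j 0 * divPow (2 * k + 1 - j) y) k]
  rw [Finset.sum_eq_zero (s := Finset.range k) (f := fun j => r ^ (2 * k - 2 * j) *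
    (divPow (2 * k + 1 - j) 0 * divPow j y))]
  · simp [divPow_succ_zero, divPow_zero_left]
  · intro j hj
    have : 2 * k + 1 - j = 2 * k - j + 1 := by have := Finset.mem_range.1 hj; omega
    simp [this, divPow_succ_zero]

theorem continuous_upVol_left (r : ℝ) (k : ℕ) (y : ℝ) : Continuous fun x => upVol r k x y := by
  have := continuous_divPow
  unfold upVol
  fun_prop

theorem continuous_downVol_right (r : ℝ) (k : ℕ) (x : ℝ) :
    Continuous fun y => downVol r k x y := by
  have := continuous_divPow
  unfold downVol
  fun_prop

/-- The left side is the value at `x = 0`, and the `x`-derivative `upVol` is nonnegative up to the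
line `y = r x`. -/
theorem divPow_le_downVol {r x y : ℝ} (hr : 0 ≤ r) (hx : 0 ≤ x) (hy : r * x ≤ y) (k : ℕ) :
    divPow (2 * k + 1) y ≤ downVol r k x y := by
  have hm : MonotoneOn (fun x => downVol r k x y) (Icc 0 x) := by
    refine monotoneOn_of_deriv_nonneg (convex_Icc 0 x)
      (fun z _ => (hasDerivAt_downVol r k z y).continuousAt.continuousWithinAt)
      (fun z _ => (hasDerivAt_downVol r k z y).differentiableAt.differentiableWithinAt)
      fun z hz => ?_
    rw [interior_Icc] at hz
    rw [(hasDerivAt_downVol r k z y).deriv]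
    exact upVol_nonneg hr hz.1.le ((mul_le_mul_of_nonneg_left hz.2.le hr).trans hy) k
  have h := hm (left_mem_Icc.2 hx) (right_mem_Icc.2 hx) hx
  simpa only [downVol_zero_left] using h

theorem downVol_nonneg {r x y : ℝ} (hr : 0 ≤ r) (hx : 0 ≤ x) (hy : r * x ≤ y) (k : ℕ) :
    0 ≤ downVol r k x y :=
  (divPow_nonneg ((mul_nonneg hr hx).trans hy)).trans (divPow_le_downVol hr hx hy k)

/-! ### Recursion on the first switching time -/

theorem lintegral_Ioo_ofReal_of_hasDerivAt {f F : ℝ → ℝ} {l r : ℝ} (hlr : l ≤ r)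
    (hF : ∀ a, HasDerivAt F (f a) a) (hf : Continuous f) (h0 : ∀ a ∈ Ioo l r, 0 ≤ f a) :
    ∫⁻ a in Ioo l r, ENNReal.ofReal (f a) = ENNReal.ofReal (F r - F l) := by
  rw [← ofReal_integral_eq_lintegral_ofReal, ← integral_Ioc_eq_integral_Ioo,
    ← intervalIntegral.integral_of_le hlr,
    intervalIntegral.integral_eq_sub_of_hasDerivAt (fun a _ => hF a)
      (hf.intervalIntegrable l r)]
  · exact (hf.integrableOn_Icc (a := l) (b := r)).mono_set Ioo_subset_Icc_self
  · exact (ae_restrict_iff' measurableSet_Ioo).2 (Filter.Eventually.of_forall h0)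

/-- A particle starts at time `s` from `p` with velocity `v`, and its velocity switches between `v`
and `w` at the times `u 0, u 1, …`. The predicate says that these times increase strictly in
`(s, t)` and that the positions at these times and at time `t` are below `β`. -/
def StaysBelow (t β : ℝ) : ℝ → ℝ → (n : ℕ) → ℝ → ℝ → (Fin n → ℝ) → Prop
  | v, _, 0, s, p, _ => p + v * (t - s) < β
  | v, w, n + 1, s, p, u => s < u 0 ∧ u 0 < t ∧ p + v * (u 0 - s) < β ∧
      StaysBelow t β w v n (u 0) (p + v * (u 0 - s)) (Fin.tail u)

/-- The starting time and position vary measurably because the recursion replaces them by functions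
of the first switch. -/
theorem measurableSet_staysBelow_comp {α : Type*} [MeasurableSpace α] (t β : ℝ) (n : ℕ) :
    ∀ (v w : ℝ) {s p : α → ℝ} {u : α → Fin n → ℝ}, Measurable s → Measurable p → Measurable u →
      MeasurableSet {a | StaysBelow t β v w n (s a) (p a) (u a)} := by
  induction n with
  | zero =>
    intro v w s p u hs hp hu
    simp only [StaysBelow]
    exact measurableSet_lt (by fun_prop) measurable_const
  | succ n ih =>
    intro v w s p u hs hp hu
    have h0 : Measurable fun a => u a 0 := (measurable_pi_apply 0).comp hu
    have ht : Measurable fun a => Fin.tail (u a) :=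
      measurable_pi_lambda _ fun i => (measurable_pi_apply i.succ).comp hu
    have hp' : Measurable fun a => p a + v * (u a 0 - s a) := by fun_prop
    exact (measurableSet_lt hs h0).inter ((measurableSet_lt h0 measurable_const).inter
      ((measurableSet_lt hp' measurable_const).inter (ih w v h0 hp' ht)))

theorem measurableSet_staysBelow (t β v w : ℝ) (n : ℕ) (s p : ℝ) :
    MeasurableSet {u | StaysBelow t β v w n s p u} :=
  measurableSet_staysBelow_comp t β n v w measurable_const measurable_const measurable_id

theorem volume_staysBelow_zero (t β v w s p : ℝ) :
    volume {u | StaysBelow t β v w 0 s p u} = if p + v * (t - s) < β then 1 else 0 := by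
  simp only [StaysBelow]
  split_ifs with h <;> simp [h, volume_pi]

/-- Tonelli, with the first switching time `a` split off. -/
theorem volume_staysBelow_succ (t β v w : ℝ) (n : ℕ) (s p : ℝ) :
    volume {u | StaysBelow t β v w (n + 1) s p u} =
      ∫⁻ a in {a | a ∈ Ioo s t ∧ p + v * (a - s) < β},
        volume {u | StaysBelow t β w v n a (p + v * (a - s)) u} := by
  have hm := measurableSet_staysBelow t β v w (n + 1) s p
  have hp : Measurable fun a : ℝ => p + v * (a - s) := by fun_prop
  have hA : MeasurableSet {a | a ∈ Ioo s t ∧ p + v * (a - s) < β} :=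
    measurableSet_Ioo.inter (measurableSet_lt hp measurable_const)
  have hvp := (volume_preserving_piFinSuccAbove (fun _ : Fin (n + 1) => ℝ) 0).symm
  rw [← hvp.measure_preimage hm.nullMeasurableSet, Measure.volume_eq_prod,
    Measure.prod_apply (hvp.measurable hm), ← lintegral_indicator hA]
  refine lintegral_congr fun a => ?_
  have key : Prod.mk a ⁻¹' ((MeasurableEquiv.piFinSuccAbove (fun _ : Fin (n + 1) => ℝ) 0).symm ⁻¹'
      {u | StaysBelow t β v w (n + 1) s p u}) =
      {u | (a ∈ Ioo s t ∧ p + v * (a - s) < β) ∧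
        StaysBelow t β w v n a (p + v * (a - s)) u} := by
    ext u
    simp [StaysBelow, MeasurableEquiv.piFinSuccAbove, Fin.tail_def, and_assoc]
  rw [key, indicator_apply]
  split_ifs with h
  · have h' : a ∈ Ioo s t ∧ p + v * (a - s) < β := h
    simp only [h', true_and]
  · have h' : ¬ (a ∈ Ioo s t ∧ p + v * (a - s) < β) := h
    simp only [h', false_and, ofPred_false, measure_empty]

theorem add_mul_lt_of_mem_Icc {t β v s p a : ℝ} (hp : p < β) (hv : p + v * (t - s) < β)
    (ha : a ∈ Icc s t) : p + v * (a - s) < β := by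
  rcases le_total 0 v with h | h
  · nlinarith [mul_le_mul_of_nonneg_left ha.2 h]
  · nlinarith [mul_nonneg (neg_nonneg.2 h) (sub_nonneg.2 ha.1)]

/-- The final position is a convex combination of those reached without any switch. -/
theorem add_mul_add_mul_lt {t β v w s p a : ℝ} (hv : p + v * (t - s) < β)
    (hw : p + w * (t - s) < β) (ha : a ∈ Ioo s t) :
    p + v * (a - s) + w * (t - a) < β := by
  rcases le_total v w with h | h
  · nlinarith [mul_nonneg (sub_nonneg.2 h) (sub_nonneg.2 ha.1.le)]
  · nlinarith [mul_nonneg (sub_nonneg.2 h) (sub_nonneg.2 ha.2.le)]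

/-- If neither velocity, kept until `t`, reaches the level, no mixture does, and this property
survives a switch. Only the ordering of the times remains as a constraint. -/
theorem volume_staysBelow_of_lt (t β : ℝ) (n : ℕ) : ∀ (v w s p : ℝ), s < t → p < β →
    p + v * (t - s) < β → p + w * (t - s) < β →
    volume {u | StaysBelow t β v w n s p u} = ENNReal.ofReal (divPow n (t - s)) := by
  induction n with
  | zero =>
    intro v w s p _ _ hv _
    rw [volume_staysBelow_zero, if_pos hv]
    simp [divPow]
  | succ n ih =>
    intro v w s p hs hp hv hw
    have hset : {a | a ∈ Ioo s t ∧ p + v * (a - s) < β} = Ioo s t :=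
      Set.ext fun a => ⟨fun h => h.1, fun h => ⟨h, add_mul_lt_of_mem_Icc hp hv (Ioo_subset_Icc_self h)⟩⟩
    rw [volume_staysBelow_succ, hset, setLIntegral_congr_fun measurableSet_Ioo
      (g := fun a => ENNReal.ofReal (divPow n (t - a))),
      lintegral_Ioo_ofReal_of_hasDerivAt (F := fun a => -divPow (n + 1) (t - a)) hs.le]
    · simp [divPow_succ_zero]
    · intro a
      have := ((hasDerivAt_divPow n (t - a)).comp a ((hasDerivAt_id a).const_sub t)).neg
      exact this.congr_deriv (by simp)
    · exact (continuous_divPow n).comp (by fun_prop)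
    · exact fun a ha => divPow_nonneg (sub_nonneg.2 ha.2.le)
    · intro a ha
      refine ih w v a _ ha.2 (add_mul_lt_of_mem_Icc hp hv (Ioo_subset_Icc_self ha)) (add_mul_add_mul_lt hv hw ha) ?_
      have : p + v * (a - s) + v * (t - a) = p + v * (t - s) := by ring
      rwa [this]

/-! ### The simplex of ordered times -/

/-- The strictly increasing sequences in `(s, t)`. -/
def orderedTimes (s t : ℝ) (n : ℕ) : Set (Fin n → ℝ) :=
  {u | StrictMono u ∧ ∀ i, u i ∈ Ioo s t}

theorem mem_orderedTimes_succ {s t : ℝ} {n : ℕ} {u : Fin (n + 1) → ℝ} :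
    u ∈ orderedTimes s t (n + 1) ↔
      s < u 0 ∧ u 0 < t ∧ Fin.tail u ∈ orderedTimes (u 0) t n := by
  refine ⟨fun h => ⟨(h.2 0).1, (h.2 0).2, fun i j hij => h.1 (Fin.succ_lt_succ_iff.2 hij),
    fun i => ⟨h.1 (Fin.succ_pos i), (h.2 _).2⟩⟩, fun ⟨h0, h1, hm, hi⟩ => ⟨?_, ?_⟩⟩
  · intro i j hij
    induction j using Fin.cases with
    | zero => exact absurd hij (Fin.not_lt_zero i)
    | succ j =>
      induction i using Fin.cases with
      | zero => exact (hi j).1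
      | succ i => exact hm (Fin.succ_lt_succ_iff.1 hij)
  · intro i
    induction i using Fin.cases with
    | zero => exact ⟨h0, h1⟩
    | succ i => exact ⟨h0.trans (hi i).1, (hi i).2⟩

theorem StaysBelow.mem_orderedTimes {t β : ℝ} {n : ℕ} : ∀ {v w s p : ℝ} {u : Fin n → ℝ},
    StaysBelow t β v w n s p u → u ∈ orderedTimes s t n := by
  induction n with
  | zero => exact fun _ => ⟨fun i => i.elim0, fun i => i.elim0⟩
  | succ n ih => exact fun h => mem_orderedTimes_succ.2 ⟨h.1, h.2.1, ih h.2.2.2⟩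

/-- A motionless particle meets no obstacle, so the volume of the simplex is a case of
`volume_staysBelow_of_lt`. -/
theorem staysBelow_zero_velocity_iff {t β p : ℝ} (hp : p < β) {n : ℕ} :
    ∀ {s : ℝ} {u : Fin n → ℝ}, StaysBelow t β 0 0 n s p u ↔ u ∈ orderedTimes s t n := by
  induction n with
  | zero =>
    intro s u
    exact ⟨StaysBelow.mem_orderedTimes, fun _ => by simpa [StaysBelow] using hp⟩
  | succ n ih =>
    intro s u
    rw [mem_orderedTimes_succ, StaysBelow]
    simp [hp, ih]

theorem volume_orderedTimes {s t : ℝ} (hst : s < t) (n : ℕ) :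
    volume (orderedTimes s t n) = ENNReal.ofReal (divPow n (t - s)) := by
  rw [← volume_staysBelow_of_lt t 1 n 0 0 s 0 hst one_pos (by simp) (by simp)]
  congr 1
  ext u
  exact (staysBelow_zero_velocity_iff one_pos).symm

theorem isOpen_orderedTimes (s t : ℝ) (n : ℕ) : IsOpen (orderedTimes s t n) := by
  have : orderedTimes s t n =
      (⋂ i, ⋂ j, ⋂ _ : i < j, {u | u i < u j}) ∩ ⋂ i, {u | u i ∈ Ioo s t} := by
    ext u
    simp only [orderedTimes, StrictMono, mem_ofPred_eq, mem_inter_iff, mem_iInter]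
  rw [this]
  refine IsOpen.inter ?_ (isOpen_iInter_of_finite fun i =>
    isOpen_Ioo.preimage (continuous_apply i))
  exact isOpen_iInter_of_finite fun i => isOpen_iInter_of_finite fun j =>
    isOpen_iInter_of_finite fun _ => isOpen_lt (continuous_apply i) (continuous_apply j)

/-! ### Volumes for the two telegraph velocities -/

section Volume

variable {c₁ c₂ t β : ℝ}

/-- The hypothesis `up` is the rising case with one switch fewer, which lets a single induction on
`k` run through both cases. -/
theorem volume_staysBelow_down (hc₁ : 0 < c₁) (hc₂ : 0 < c₂) (k : ℕ)
    (up : ∀ s p, s < t → p < β → β ≤ p + c₁ * (t - s) →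
      volume {u | StaysBelow t β c₁ (-c₂) (2 * k) s p u} = ENNReal.ofReal (upVol (c₂ / c₁) k
        ((c₁ * (t - s) - (β - p)) / (c₁ + c₂)) ((c₂ * (t - s) + (β - p)) / (c₁ + c₂))))
    (s p : ℝ) (hs : s < t) (hp : p < β) (hx : β ≤ p + c₁ * (t - s)) :
    volume {u | StaysBelow t β (-c₂) c₁ (2 * k + 1) s p u} =
      ENNReal.ofReal (downVol (c₂ / c₁) k
        ((c₁ * (t - s) - (β - p)) / (c₁ + c₂)) ((c₂ * (t - s) + (β - p)) / (c₁ + c₂))) := by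
  have hc : 0 < c₁ + c₂ := add_pos hc₁ hc₂
  set x := (c₁ * (t - s) - (β - p)) / (c₁ + c₂) with hxdef
  set y := (c₂ * (t - s) + (β - p)) / (c₁ + c₂) with hydef
  have hx0 : 0 ≤ x := div_nonneg (by linarith) hc.le
  have hy0 : 0 < y := div_pos (by nlinarith [mul_pos hc₂ (sub_pos.2 hs)]) hc
  have hxy : x + y = t - s := by rw [hxdef, hydef]; field_simp; ring
  have hryx : c₂ / c₁ * x ≤ y := by
    have : y - c₂ / c₁ * x = (β - p) / c₁ := by rw [hxdef, hydef]; field_simp; ring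
    have h2 : 0 < (β - p) / c₁ := div_pos (by linarith) hc₁
    linarith
  have hr : 0 ≤ c₂ / c₁ := (div_pos hc₂ hc₁).le
  have hpa : ∀ a, s < a → p + -c₂ * (a - s) < β := fun a ha => by
    nlinarith [mul_pos hc₂ (sub_pos.2 ha)]
  -- A particle turning upwards at time `s + x` and rising until `t` ends exactly at the level.
  -- Earlier turns leave the level reachable; after later ones every ordered sequence is admissible.
  have hset : {a | a ∈ Ioo s t ∧ p + -c₂ * (a - s) < β} = Ioc s (s + x) ∪ Ioo (s + x) t := by
    rw [Ioc_union_Ioo_eq_Ioo (by linarith) (by linarith)]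
    exact Set.ext fun a => ⟨fun h => h.1, fun h => ⟨h, hpa a h.1⟩⟩
  have hdisj : Disjoint (Ioc s (s + x)) (Ioo (s + x) t) :=
    Set.disjoint_left.2 fun a h1 h2 => absurd h1.2 (not_le.2 h2.1)
  rw [volume_staysBelow_succ, hset, lintegral_union measurableSet_Ioo hdisj,
    setLIntegral_congr Ioo_ae_eq_Ioc.symm,
    setLIntegral_congr_fun measurableSet_Ioo
      (g := fun a => ENNReal.ofReal (upVol (c₂ / c₁) k (x - (a - s)) y)),
    setLIntegral_congr_fun (s := Ioo (s + x) t) measurableSet_Ioo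
      (g := fun a => ENNReal.ofReal (divPow (2 * k) (t - a))),
    lintegral_Ioo_ofReal_of_hasDerivAt (F := fun a => -downVol (c₂ / c₁) k (x - (a - s)) y)
      (by linarith),
    lintegral_Ioo_ofReal_of_hasDerivAt (F := fun a => -divPow (2 * k + 1) (t - a)) (by linarith)]
  · have e1 : x - (s + x - s) = 0 := by ring
    have e2 : t - (s + x) = y := by linarith
    simp only [e1, e2, sub_self, sub_zero, downVol_zero_left, divPow_succ_zero]
    rw [← ENNReal.ofReal_add]
    · congr 1; ring
    · have := divPow_le_downVol hr hx0 hryx k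
      linarith
    · have := divPow_nonneg (n := 2 * k + 1) hy0.le
      linarith
  · intro a
    have := ((hasDerivAt_divPow (2 * k) (t - a)).comp a ((hasDerivAt_id a).const_sub t)).neg
    exact this.congr_deriv (by simp)
  · exact (continuous_divPow _).comp (by fun_prop)
  · exact fun a ha => divPow_nonneg (sub_nonneg.2 ha.2.le)
  · intro a
    have := ((hasDerivAt_downVol (c₂ / c₁) k (x - (a - s)) y).comp a
      (((hasDerivAt_id a).sub_const s).const_sub x)).neg
    exact this.congr_deriv (by simp)
  · exact (continuous_upVol_left _ k y).comp (by fun_prop)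
  · intro a ha
    refine upVol_nonneg hr (by linarith [ha.2]) (le_trans ?_ hryx) k
    exact mul_le_mul_of_nonneg_left (by linarith [ha.1]) hr
  · intro a ha
    have hsa : s < a := by linarith [ha.1]
    have hxa : p + -c₂ * (a - s) + c₁ * (t - a) < β := by
      have h1 : (c₁ + c₂) * x = c₁ * (t - s) - (β - p) := by rw [hxdef]; field_simp
      nlinarith [mul_pos hc (sub_pos.2 ha.1)]
    refine volume_staysBelow_of_lt t β (2 * k) c₁ (-c₂) a _ ha.2 (hpa a hsa) hxa ?_
    nlinarith [mul_pos hc₂ (sub_pos.2 hsa), mul_pos hc₂ (sub_pos.2 ha.2)]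
  · intro a ha
    have h1 : (c₁ + c₂) * x = c₁ * (t - s) - (β - p) := by rw [hxdef]; field_simp
    have hxa : β ≤ p + -c₂ * (a - s) + c₁ * (t - a) := by
      nlinarith [mul_pos hc (sub_pos.2 ha.2)]
    have e1 : (c₁ * (t - a) - (β - (p + -c₂ * (a - s)))) / (c₁ + c₂) = x - (a - s) := by
      rw [hxdef]; field_simp; ring
    have e2 : (c₂ * (t - a) + (β - (p + -c₂ * (a - s)))) / (c₁ + c₂) = y := by
      rw [hydef]; congr 1; ring
    have := up a _ (by linarith [ha.2]) (hpa a ha.1) hxa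
    rwa [e1, e2] at this

theorem volume_staysBelow_up (hc₁ : 0 < c₁) (hc₂ : 0 < c₂) (k : ℕ) :
    ∀ s p, s < t → p < β → β ≤ p + c₁ * (t - s) →
      volume {u | StaysBelow t β c₁ (-c₂) (2 * k) s p u} = ENNReal.ofReal (upVol (c₂ / c₁) k
        ((c₁ * (t - s) - (β - p)) / (c₁ + c₂)) ((c₂ * (t - s) + (β - p)) / (c₁ + c₂))) := by
  induction k with
  | zero =>
    intro s p _ _ hx
    -- Without a switch the particle ends at or above the level, and `upVol` is an empty sum.
    rw [Nat.mul_zero, volume_staysBelow_zero, if_neg hx.not_gt]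
    simp [upVol]
  | succ k ih =>
    intro s p hs hp hx
    have down := volume_staysBelow_down hc₁ hc₂ k ih
    have hc : 0 < c₁ + c₂ := add_pos hc₁ hc₂
    set x := (c₁ * (t - s) - (β - p)) / (c₁ + c₂) with hxdef
    set y := (c₂ * (t - s) + (β - p)) / (c₁ + c₂) with hydef
    have hx0 : 0 ≤ x := div_nonneg (by linarith) hc.le
    have hryx : y - (β - p) / c₁ = c₂ / c₁ * x := by rw [hxdef, hydef]; field_simp; ring
    have hr : 0 ≤ c₂ / c₁ := (div_pos hc₂ hc₁).le
    have hg : 0 < (β - p) / c₁ := div_pos (by linarith) hc₁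
    have hg1 : c₁ * ((β - p) / c₁) = β - p := by field_simp
    have hgt : (β - p) / c₁ ≤ t - s := by
      rw [div_le_iff₀ hc₁]; linarith
    -- The first switch must precede the hitting time of the level. At that time `y` has dropped to
    -- `r x`, where `upVol` vanishes.
    have hset : {a | a ∈ Ioo s t ∧ p + c₁ * (a - s) < β} = Ioo s (s + (β - p) / c₁) := by
      ext a
      refine ⟨fun h => ⟨h.1.1, ?_⟩, fun h => ⟨⟨h.1, by linarith [h.2]⟩, ?_⟩⟩
      · have := lt_of_mul_lt_mul_left (a := c₁) (b := a - s) (c := (β - p) / c₁)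
          (by linarith [h.2]) hc₁.le
        linarith
      · nlinarith [mul_lt_mul_of_pos_left h.2 hc₁]
    rw [show 2 * (k + 1) = 2 * k + 1 + 1 by ring, volume_staysBelow_succ, hset,
      setLIntegral_congr_fun measurableSet_Ioo
        (g := fun a => ENNReal.ofReal (downVol (c₂ / c₁) k x (y - (a - s)))),
      lintegral_Ioo_ofReal_of_hasDerivAt
        (F := fun a => -upVol (c₂ / c₁) (k + 1) x (y - (a - s))) (by linarith)]
    · rw [add_sub_cancel_left, hryx, upVol_diag]
      simp
    · intro a
      have := ((hasDerivAt_upVol (c₂ / c₁) k x (y - (a - s))).comp a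
        (((hasDerivAt_id a).sub_const s).const_sub y)).neg
      exact this.congr_deriv (by simp)
    · exact (continuous_downVol_right _ k x).comp (by fun_prop)
    · exact fun a ha => downVol_nonneg hr hx0 (by linarith [ha.2]) k
    · intro a ha
      have ha' : p + c₁ * (a - s) < β := (hset ▸ ha : a ∈ {a | _ ∧ _}).2
      have e1 : (c₁ * (t - a) - (β - (p + c₁ * (a - s)))) / (c₁ + c₂) = x := by
        rw [hxdef]; congr 1; ring
      have e2 : (c₂ * (t - a) + (β - (p + c₁ * (a - s)))) / (c₁ + c₂) = y - (a - s) := by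
        rw [hydef]; field_simp; ring
      have := down a _ (by linarith [ha.2]) ha' (by linarith)
      rwa [e1, e2] at this

end Volume

/-! ### From sample paths to switching times -/

/-- On each affine piece the endpoints control the values. The count `m` at the start is arbitrary
so that the induction can restart at `u 0`; the period two of `vel` swaps the velocities. -/
theorem forall_lt_iff_staysBelow {vel : ℕ → ℝ} (hvel : ∀ m, vel (m + 2) = vel m) {M : ℝ → ℕ}
    {X : ℝ → ℝ} {t β : ℝ} (n : ℕ) : ∀ {m : ℕ} {s : ℝ} {u : Fin n → ℝ}, s ≤ t →
    u ∈ orderedTimes s t n → (∀ r ∈ Icc s t, m ≤ M r ∧ M r ≤ m + n) →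
    (∀ i : Fin n, ∀ r ∈ Icc s t, (m + i + 1 ≤ M r ↔ u i ≤ r)) →
    (∀ j a b, s ≤ a → a ≤ b → b ≤ t → (∀ r ∈ Ico a b, M r = j) →
      X b = X a + vel j * (b - a)) → X s < β →
    ((∀ r ∈ Icc s t, X r < β) ↔ StaysBelow t β (vel m) (vel (m + 1)) n s (X s) u) := by
  induction n with
  | zero =>
    intro m s u hst _ hM _ hX hs
    have hr : ∀ r ∈ Icc s t, X r = X s + vel m * (r - s) := fun r hr =>
      hX m s r le_rfl hr.1 hr.2 fun q hq =>
        le_antisymm (hM q ⟨hq.1, hq.2.le.trans hr.2⟩).2 (hM q ⟨hq.1, hq.2.le.trans hr.2⟩).1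
    refine ⟨fun h => ?_, fun h r hrm => ?_⟩
    · have := h t ⟨hst, le_rfl⟩
      rwa [hr t ⟨hst, le_rfl⟩] at this
    · rw [hr r hrm]
      exact add_mul_lt_of_mem_Icc hs h hrm
  | succ n ih =>
    intro m s u hst hu hM hj hX hs
    obtain ⟨h0, h1, htail⟩ := mem_orderedTimes_succ.1 hu
    have hr : ∀ r ∈ Icc s (u 0), X r = X s + vel m * (r - s) := fun r hr =>
      hX m s r le_rfl hr.1 (hr.2.trans h1.le) fun q hq => by
        have hq' : q ∈ Icc s t := ⟨hq.1, hq.2.le.trans (hr.2.trans h1.le)⟩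
        have h2 := (hj 0 q hq').not.2 (not_le.2 (hq.2.trans_le hr.2))
        have h3 := (hM q hq').1
        simp only [Fin.val_zero] at h2
        omega
    have e0 := hr (u 0) ⟨h0.le, le_rfl⟩
    have hIH := fun h => ih (m := m + 1) (s := u 0) (u := Fin.tail u) h1.le htail
      (fun r hr => by
        have hr' : r ∈ Icc s t := ⟨h0.le.trans hr.1, hr.2⟩
        have h2 := (hj 0 r hr').2 hr.1
        have h3 := (hM r hr').2
        simp only [Fin.val_zero] at h2
        omega)
      (fun i r hr => by
        have := hj i.succ r ⟨h0.le.trans hr.1, hr.2⟩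
        rw [Fin.val_succ] at this
        rw [show m + 1 + (i : ℕ) + 1 = m + (i + 1) + 1 by ring]
        exact this)
      (fun j a b ha => hX j a b (h0.le.trans ha)) h
    rw [StaysBelow, ← e0]
    have e2 : vel (m + 1 + 1) = vel m := hvel m
    rw [e2] at hIH
    refine ⟨fun h => ⟨h0, h1, h _ ⟨h0.le, h1.le⟩, (hIH (h _ ⟨h0.le, h1.le⟩)).1 fun r hr =>
      h r ⟨h0.le.trans hr.1, hr.2⟩⟩, fun ⟨_, _, h2, h3⟩ r hrm => ?_⟩
    rcases le_total r (u 0) with h4 | h4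
    · rw [hr r ⟨hrm.1, h4⟩]
      rw [e0] at h2
      exact add_mul_lt_of_mem_Icc hs h2 ⟨hrm.1, h4⟩
    · exact (hIH h2).2 h3 r ⟨h4, hrm.2⟩

/-- The time of the jump number `i + 1` of the counting path `f`, truncated at `t`. -/
noncomputable def jumpTime (f : ℝ≥0 → ℕ) (t : ℝ≥0) (i : ℕ) : ℝ :=
  (⨅ q : ℚ, if i + 1 ≤ f (q : ℝ).toNNReal then ((q : ℝ).toNNReal : ℝ≥0∞) else t).toReal

/-- Taking the infimum over rational times only makes it countable. -/
theorem measurable_jumpTime {Ω : Type*} [MeasurableSpace Ω] {N : ℝ≥0 → Ω → ℕ}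
    (hN : ∀ t, Measurable (N t)) (t : ℝ≥0) (i : ℕ) :
    Measurable fun ω => jumpTime (fun s => N s ω) t i := by
  refine (Measurable.iInf fun q => ?_).ennreal_toReal
  exact Measurable.ite (measurableSet_le measurable_const (hN _)) measurable_const measurable_const

/-- Right continuity puts the infimum itself among the times with at least `i + 1` events: an
integer-valued path is constant just after `r`, so a count below `i + 1` at `r < t` would push the
infimum strictly past `r`. -/
theorem jumpTime_le_iff {f : ℝ≥0 → ℕ} {t : ℝ≥0} {i : ℕ} (hf : Monotone f)
    (hc : ∀ s, ContinuousWithinAt f (Ici s) s) (hi : i + 1 ≤ f t) {r : ℝ} (hr : r ∈ Icc 0 (t : ℝ)) :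
    jumpTime f t i ≤ r ↔ i + 1 ≤ f r.toNNReal := by
  set T : ℝ≥0∞ := ⨅ q : ℚ, if i + 1 ≤ f (q : ℝ).toNNReal then ((q : ℝ).toNNReal : ℝ≥0∞) else t
    with hT
  have hTt : T ≤ t := by
    refine (iInf_le _ 0).trans ?_
    split_ifs <;> simp
  lift r to ℝ≥0 using hr.1
  have hrt : r ≤ t := by exact_mod_cast hr.2
  rw [Real.toNNReal_coe]
  have h1 : jumpTime f t i ≤ r ↔ T ≤ r := by
    rw [← ENNReal.toReal_le_toReal (ne_top_of_le_ne_top ENNReal.coe_ne_top hTt)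
      ENNReal.coe_ne_top]
    rfl
  rw [h1]
  refine ⟨fun h => ?_, fun h => ?_⟩
  · by_contra hlt
    have hrt' : r < t := lt_of_le_of_ne hrt fun e => hlt (e ▸ hi)
    have hev : ∀ᶠ s in nhdsWithin r (Ioi r), f s = f r := by
      have := (hc r).mono Ioi_subset_Ici_self
      exact this.eventually_mem (s := {f r}) (by simp [nhds_discrete])
    obtain ⟨s, hs1, hs2⟩ := (hev.and (Ioo_mem_nhdsGT hrt')).exists
    have hsT : (s : ℝ≥0∞) ≤ T := by
      refine le_iInf fun q => ?_
      split_ifs with hq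
      · rw [ENNReal.coe_le_coe]
        by_contra hqs
        exact hlt (hs1 ▸ hq.trans (hf (not_le.1 hqs).le))
      · exact_mod_cast hs2.2.le
    exact absurd (hsT.trans h) (by simpa using hs2.1)
  · by_contra hlt
    obtain ⟨q, _, hq1, hq2⟩ := ENNReal.lt_iff_exists_rat_btwn.1 (not_le.1 hlt)
    have hq3 : r ≤ (q : ℝ).toNNReal := by exact_mod_cast hq1.le
    have : T ≤ ((q : ℝ).toNNReal : ℝ≥0∞) := by
      refine (iInf_le _ q).trans ?_
      rw [if_pos (h.trans (hf hq3))]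
    exact absurd this (not_le.2 hq2)

section Path

variable {Ω : Type*} {c₁ c₂ : ℝ} {V₀ : Ω → ℝ} {N : ℝ≥0 → Ω → ℕ} {t : ℝ≥0} {ω : Ω}

theorem telegraphVelocity_of_init_eq (hV : V₀ ω = c₁) (s : ℝ≥0) :
    telegraphVelocity c₁ c₂ V₀ N s ω = if Even (N s ω) then c₁ else -c₂ := by
  simp [telegraphVelocity, hV]

theorem intervalIntegrable_telegraphVelocity (hV : V₀ ω = c₁) (hN : Monotone fun s => N s ω)
    (a b : ℝ) : IntervalIntegrable
      (fun s : ℝ => telegraphVelocity c₁ c₂ V₀ N s.toNNReal ω) volume a b := by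
  simp only [telegraphVelocity_of_init_eq hV]
  have hm : Measurable fun s : ℝ => N s.toNNReal ω := hN.measurable.comp measurable_real_toNNReal
  have hm' : Measurable fun s : ℝ => if Even (N s.toNNReal ω) then c₁ else -c₂ :=
    (measurable_from_nat (f := fun n => if Even n then c₁ else -c₂)).comp hm
  refine (intervalIntegrable_const (c := |c₁| + |c₂|)).mono_fun hm'.aestronglyMeasurable
    (Filter.Eventually.of_forall fun s => ?_)
  have h2 := abs_nonneg c₁
  have h3 := abs_nonneg c₂
  simp only [Real.norm_eq_abs]
  rw [abs_of_nonneg (add_nonneg h2 h3)]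
  split_ifs <;> (try rw [abs_neg]) <;> linarith

theorem telegraph_eq_add_of_constant (hV : V₀ ω = c₁) (hN : Monotone fun s => N s ω) {j : ℕ}
    {a b : ℝ} (ha : 0 ≤ a) (hab : a ≤ b) (hj : ∀ r ∈ Ico a b, N r.toNNReal ω = j) :
    telegraph c₁ c₂ V₀ N b.toNNReal ω =
      telegraph c₁ c₂ V₀ N a.toNNReal ω + (if Even j then c₁ else -c₂) * (b - a) := by
  have hint := intervalIntegrable_telegraphVelocity (c₂ := c₂) hV hN
  unfold telegraph
  rw [Real.coe_toNNReal a ha, Real.coe_toNNReal b (ha.trans hab),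
    ← intervalIntegral.integral_add_adjacent_intervals (hint 0 a) (hint a b),
    intervalIntegral.integral_congr_Ioo_of_le (g := fun _ => if Even j then c₁ else -c₂) hab]
  · simp [mul_comm]
  · intro r hr
    simp only [telegraphVelocity_of_init_eq hV, hj r ⟨hr.1.le, hr.2⟩]

theorem telegraphMax_lt_iff {β : ℝ} (hN : Monotone fun s => N s ω) :
    telegraphMax c₁ c₂ V₀ N t ω < β ↔
      ∀ r ∈ Icc 0 (t : ℝ), telegraph c₁ c₂ V₀ N r.toNNReal ω < β := by
  have hg := isGreatest_telegraphMax c₁ c₂ V₀ N t ω hN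
  refine ⟨fun h r hr => (hg.2 ⟨r.toNNReal, ⟨zero_le, ?_⟩, rfl⟩).trans_lt h, fun h => ?_⟩
  · exact Real.toNNReal_le_iff_le_coe.2 hr.2
  · obtain ⟨s, hs, hs'⟩ := hg.1
    rw [← hs']
    have := h s ⟨s.2, by exact_mod_cast hs.2⟩
    rwa [Real.toNNReal_coe] at this

theorem telegraphMax_lt_iff_staysBelow {β : ℝ} {n : ℕ} (hβ : 0 < β) (hV : V₀ ω = c₁)
    (hN : Monotone fun s => N s ω) (hc : ∀ s, ContinuousWithinAt (fun s => N s ω) (Ici s) s)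
    (hn : N t ω = n)
    (hT : (fun i : Fin n => jumpTime (fun s => N s ω) t i) ∈ orderedTimes 0 t n) :
    telegraphMax c₁ c₂ V₀ N t ω < β ↔ StaysBelow t β c₁ (-c₂) n 0 0
      fun i => jumpTime (fun s => N s ω) t i := by
  have h0 : telegraph c₁ c₂ V₀ N 0 ω = 0 := by simp [telegraph]
  have h := forall_lt_iff_staysBelow (vel := fun j => if Even j then c₁ else -c₂)
    (M := fun r => N r.toNNReal ω) (X := fun r => telegraph c₁ c₂ V₀ N r.toNNReal ω) (β := β)
    (fun m => by simp [Nat.even_add]) n (m := 0) t.2 hT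
    (fun r hr => ⟨Nat.zero_le _, by
      rw [zero_add, ← hn]; exact hN (Real.toNNReal_le_iff_le_coe.2 hr.2)⟩)
    (fun i r hr => by
      rw [jumpTime_le_iff hN hc (by rw [hn]; exact i.2) hr, zero_add])
    (fun j a b ha hab _ hj => telegraph_eq_add_of_constant hV hN ha hab hj)
    (by simpa [h0] using hβ)
  rw [telegraphMax_lt_iff hN]
  simpa [h0] using h

end Path

/-! ### Measures determined by boxes inside an open set -/

theorem measure_ext_of_boxes {ι : Type*} [Finite ι] {U : Set (ι → ℝ)} (hU : IsOpen U)
    {m₁ m₂ : Measure (ι → ℝ)} [IsFiniteMeasure m₁] (h₁ : m₁ Uᶜ = 0) (h₂ : m₂ Uᶜ = 0)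
    (h : ∀ a b : ι → ℝ, Icc a b ⊆ U → a ≤ b →
      m₁ (univ.pi fun i => Ioc (a i) (b i)) = m₂ (univ.pi fun i => Ioc (a i) (b i))) :
    m₁ = m₂ := by
  have := Fintype.ofFinite ι
  set box : (ι → ℝ) → (ι → ℝ) → Set (ι → ℝ) := fun a b => univ.pi fun i => Ioc (a i) (b i)
  have hbm : ∀ a b, MeasurableSet (box a b) := fun a b =>
    MeasurableSet.univ_pi fun _ => measurableSet_Ioc
  have hsub : ∀ a b, box a b ⊆ Icc a b := fun a b x hx =>
    ⟨fun i => (hx i trivial).1.le, fun i => (hx i trivial).2⟩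
  -- Subsets of `Uᶜ`, null for both measures, are added so that this π-system generates all Borel
  -- sets; `T` is a countable cover of the space drawn from it.
  set S : Set (Set (ι → ℝ)) :=
    {s | MeasurableSet s ∧ (s ⊆ Uᶜ ∨ ∃ a b, Icc a b ⊆ U ∧ a ≤ b ∧ s = box a b)}
  set T : Set (Set (ι → ℝ)) := insert Uᶜ
    {s | ∃ a b : ι → ℚ, (Icc (fun i => (a i : ℝ)) (fun i => (b i : ℝ)) ⊆ U ∧
      (fun i => (a i : ℝ)) ≤ fun i => (b i : ℝ)) ∧
      s = box (fun i => (a i : ℝ)) (fun i => (b i : ℝ))}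
  have hTS : T ⊆ S := by
    rintro s (rfl | ⟨a, b, ⟨h1, h2⟩, rfl⟩)
    · exact ⟨hU.measurableSet.compl, Or.inl subset_rfl⟩
    · exact ⟨hbm _ _, Or.inr ⟨_, _, h1, h2, rfl⟩⟩
  have hTc : T.Countable := by
    refine Countable.insert _ ?_
    refine (countable_range fun ab : (ι → ℚ) × (ι → ℚ) =>
      box (fun i => (ab.1 i : ℝ)) (fun i => (ab.2 i : ℝ))).mono ?_
    rintro s ⟨a, b, _, rfl⟩
    exact ⟨(a, b), rfl⟩
  have hcover : ∀ V : Set (ι → ℝ), IsOpen V → V ⊆ U → ∀ u ∈ V, ∃ s ∈ T, u ∈ s ∧ s ⊆ V := by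
    intro V hV hVU u hu
    obtain ⟨ε, hε, hball⟩ := Metric.isOpen_iff.1 hV u hu
    choose a ha using fun i => exists_rat_btwn (sub_lt_self (u i) (half_pos hε))
    choose b hb using fun i => exists_rat_btwn (lt_add_of_pos_right (u i) (half_pos hε))
    have hIcc : Icc (fun i => (a i : ℝ)) (fun i => (b i : ℝ)) ⊆ V := by
      refine fun x hx => hball ?_
      rw [Metric.mem_ball]
      refine lt_of_le_of_lt ((dist_pi_le_iff (half_pos hε).le).2 fun i => ?_) (half_lt_self hε)
      rw [Real.dist_eq, abs_le]
      have h1 := hx.1 i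
      have h2 := hx.2 i
      have h3 := ha i
      have h4 := hb i
      simp only at h1 h2
      constructor <;> linarith
    exact ⟨_, Or.inr ⟨a, b, ⟨hIcc.trans hVU, fun i => ((ha i).2.trans (hb i).1).le⟩, rfl⟩,
      fun i _ => ⟨(ha i).2, (hb i).1.le⟩, (hsub _ _).trans hIcc⟩
  have heq : ∀ s ∈ S, m₁ s = m₂ s := by
    rintro s ⟨_, hs | ⟨a, b, hab, hle, rfl⟩⟩
    · rw [measure_mono_null hs h₁, measure_mono_null hs h₂]
    · exact h a b hab hle
  refine Measure.ext_of_generateFrom_of_cover_subset (S := S) (T := T) ?_ ?_ hTS hTc ?_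
    (fun s _ => measure_ne_top _ s) heq
  · refine le_antisymm ?_ (MeasurableSpace.generateFrom_le fun s hs => hs.1)
    rw [BorelSpace.measurable_eq (α := ι → ℝ)]
    refine MeasurableSpace.generateFrom_le fun V (hV : IsOpen V) => ?_
    have hdec : V = V ∩ Uᶜ ∪ ⋃₀ {s | s ∈ T ∧ s ⊆ V ∩ U} := by
      refine subset_antisymm (fun u hu => ?_) ?_
      · by_cases huU : u ∈ U
        · obtain ⟨s, hs, hus, hsV⟩ := hcover (V ∩ U) (hV.inter hU) inter_subset_right u ⟨hu, huU⟩
          exact Or.inr ⟨s, ⟨hs, hsV⟩, hus⟩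
        · exact Or.inl ⟨hu, huU⟩
      · exact union_subset inter_subset_left
          (sUnion_subset fun s hs => hs.2.trans inter_subset_left)
    rw [hdec]
    refine MeasurableSet.union (MeasurableSpace.measurableSet_generateFrom
      ⟨hV.measurableSet.inter hU.measurableSet.compl, Or.inl inter_subset_right⟩) ?_
    exact MeasurableSet.sUnion (hTc.mono fun s hs => hs.1) fun s hs =>
      MeasurableSpace.measurableSet_generateFrom (hTS hs.1)
  · rintro s ⟨hs, hs'⟩ s' ⟨ht, ht'⟩ hne
    refine ⟨hs.inter ht, ?_⟩
    rcases hs' with hs' | ⟨a, b, hab, hle, rfl⟩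
    · exact Or.inl (inter_subset_left.trans hs')
    rcases ht' with ht' | ⟨a', b', hab', hle', rfl⟩
    · exact Or.inl (inter_subset_right.trans ht')
    refine Or.inr ⟨a ⊔ a', b ⊓ b', (Icc_subset_Icc le_sup_left inf_le_left).trans hab, ?_, ?_⟩
    · obtain ⟨x, hx, hx'⟩ := hne
      intro i
      have h1 := hx i trivial
      have h2 := hx' i trivial
      exact (max_lt h1.1 h2.1).le.trans (le_min h1.2 h2.2)
    · simp only [box, ← pi_inter_distrib, Ioc_inter_Ioc, Pi.sup_apply, Pi.inf_apply]
  · refine eq_univ_of_forall fun u => ?_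
    by_cases hu : u ∈ U
    · obtain ⟨s, hs, hus, _⟩ := hcover U hU subset_rfl u hu
      exact ⟨s, hs, hus⟩
    · exact ⟨Uᶜ, Or.inl rfl, hu⟩

/-! ### Law of the jump times -/

theorem exists_monotone_interlacing {n : ℕ} {a b : Fin n → ℝ} {t : ℝ≥0}
    (hab : Icc a b ⊆ orderedTimes 0 t n) (hle : a ≤ b) :
    ∃ τ : ℕ → ℝ≥0, Monotone τ ∧ τ 0 = 0 ∧ τ (2 * n + 1) = t ∧
      ∀ i : Fin n, (τ (2 * i + 1) : ℝ) = a i ∧ (τ (2 * i + 2) : ℝ) = b i := by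
  have ha := hab (left_mem_Icc.2 hle)
  have hb := hab (right_mem_Icc.2 hle)
  have hba : ∀ i j, i < j → b i ≤ a j := by
    intro i j hij
    -- This corner of the box has ordered coordinates, which separates the intervals.
    have hmem : (fun l => if l ≤ i then b l else a l) ∈ Icc a b := by
      constructor <;> intro l <;> dsimp only <;> split_ifs
      exacts [hle l, le_rfl, le_rfl, hle l]
    have := (hab hmem).1 hij
    simp only [le_refl, if_true, not_le.2 hij, if_false] at this
    exact this.le
  -- The sequence will be `0, a₀, b₀, a₁, b₁, …`; the default value `t` closes it at index `2n + 1`.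
  set A : ℕ → ℝ≥0 := fun i => if h : i < n then (a ⟨i, h⟩).toNNReal else t
  set B : ℕ → ℝ≥0 := fun i => if h : i < n then (b ⟨i, h⟩).toNNReal else t
  have hAB : ∀ i, A i ≤ B i := fun i => by
    simp only [A, B]
    split_ifs with h
    · exact Real.toNNReal_le_toNNReal (hle _)
    · exact le_rfl
  have hBA : ∀ i, B i ≤ A (i + 1) := fun i => by
    simp only [A, B]
    split_ifs with h h' h'
    · exact Real.toNNReal_le_toNNReal (hba _ _ (by simp))
    · exact Real.toNNReal_le_iff_le_coe.2 (hb.2 _).2.le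
    · omega
    · exact le_rfl
  refine ⟨fun j => Nat.casesOn j 0 fun j => if Even j then A (j / 2) else B (j / 2),
    monotone_nat_of_le_succ fun j => ?_, rfl, ?_, fun i => ⟨?_, ?_⟩⟩
  · cases j with
    | zero => exact zero_le
    | succ j =>
      dsimp only
      rcases Nat.even_or_odd' j with ⟨i, rfl | rfl⟩
      · have h1 : (2 * i + 1) / 2 = i := by omega
        simpa [h1] using hAB i
      · have h1 : (2 * i + 1) / 2 = i := by omega
        have h2 : (2 * i + 1 + 1) / 2 = i + 1 := by omega
        have h3 : Even (2 * i + 1 + 1) := ⟨i + 1, by ring⟩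
        simpa [h1, h2, h3] using hBA i
  · simp [A]
  · simp [A, Real.coe_toNNReal _ (ha.2 i).1.le]
  · have h1 : (2 * (i : ℕ) + 1) / 2 = i := by omega
    simp [B, h1, Real.coe_toNNReal _ (hb.2 i).1.le]

theorem prod_range_two_mul {M : Type*} [CommMonoid M] (f : ℕ → M) (n : ℕ) :
    ∏ j ∈ Finset.range (2 * n), f j = ∏ i ∈ Finset.range n, f (2 * i) * f (2 * i + 1) := by
  induction n with
  | zero => simp
  | succ n ih =>
    rw [show 2 * (n + 1) = 2 * n + 1 + 1 by ring, Finset.prod_range_succ, Finset.prod_range_succ,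
      ih, Finset.prod_range_succ, mul_assoc]

section Law

variable {Ω : Type*} [MeasurableSpace Ω] {μ : Measure Ω} {c₁ c₂ : ℝ}
  {lam : ℝ≥0} {V₀ : Ω → ℝ} {N : ℝ≥0 → Ω → ℕ}

theorem IsPoissonProcess.measure_increment_eq (h : IsPoissonProcess lam N μ) {s t : ℝ≥0}
    (hst : s ≤ t) (m : ℕ) : μ {ω | N t ω - N s ω = m} =
      ENNReal.ofReal (Real.exp (-(lam * (t - s))) * (lam * (t - s)) ^ m / m.factorial) := by
  have hm : Measurable fun ω => N t ω - N s ω := (h.measurable t).sub (h.measurable s)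
  have := congrArg (fun ν => ν {m}) (h.lawIncrements s t hst)
  rw [Measure.map_apply hm (measurableSet_singleton m), poissonMeasure_singleton] at this
  simp only [NNReal.coe_mul, NNReal.coe_sub hst] at this
  exact this

theorem IsTelegraphInput.measure_init (h : IsTelegraphInput c₁ c₂ lam V₀ N μ) (hc₁ : 0 < c₁)
    (hc₂ : 0 < c₂) : μ {ω | V₀ ω = c₁} = 2⁻¹ := by
  have := congrArg (fun ν => ν {c₁}) h.law_init
  rw [Measure.map_apply h.measurable_init (measurableSet_singleton c₁)] at this
  have hne : -c₂ ≠ c₁ := by linarith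
  refine Eq.trans ?_ (this.trans (by simp [hne]))
  rfl

theorem IsTelegraphInput.measure_init_inter (h : IsTelegraphInput c₁ c₂ lam V₀ N μ) (hc₁ : 0 < c₁)
    (hc₂ : 0 < c₂) {A : Set (ℝ≥0 → ℕ)} (hA : MeasurableSet A) :
    μ ({ω | V₀ ω = c₁} ∩ {ω | (fun t => N t ω) ∈ A}) =
      2⁻¹ * μ {ω | (fun t => N t ω) ∈ A} := by
  rw [← h.measure_init hc₁ hc₂]
  exact h.indep_init.measure_inter_preimage_eq_mul {c₁} A (measurableSet_singleton c₁) hA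

/-- No event in the even gaps and one in each odd gap: the exponentials telescope, and each odd gap
contributes `lam` times its length, hence a constant density. -/
theorem IsPoissonProcess.measure_alternating (h : IsPoissonProcess lam N μ) (n : ℕ) {τ : ℕ → ℝ≥0}
    (hτ : Monotone τ) (h0 : τ 0 = 0) :
    μ {ω | ∀ j ∈ Finset.range (2 * n + 1), N (τ (j + 1)) ω - N (τ j) ω = j % 2} =
      ENNReal.ofReal (Real.exp (-(lam * τ (2 * n + 1))) * lam ^ n *
        ∏ i ∈ Finset.range n, ((τ (2 * i + 2) : ℝ) - τ (2 * i + 1))) := by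
  have hi := (h.indepIncrements.nat hτ).measure_inter_preimage_eq_mul
    (Finset.range (2 * n + 1)) (sets := fun j => {j % 2}) fun _ _ => measurableSet_singleton _
  have hset : {ω | ∀ j ∈ Finset.range (2 * n + 1), N (τ (j + 1)) ω - N (τ j) ω = j % 2} =
      ⋂ j ∈ Finset.range (2 * n + 1),
        (fun ω => N (τ (j + 1)) ω - N (τ j) ω) ⁻¹' {j % 2} := by
    ext ω; simp
  rw [hset, hi]
  have hp : ∀ j, μ ((fun ω => N (τ (j + 1)) ω - N (τ j) ω) ⁻¹' {j % 2}) =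
      ENNReal.ofReal (Real.exp (lam * τ j - lam * τ (j + 1)) *
        ((lam * ((τ (j + 1) : ℝ) - τ j)) ^ (j % 2))) := by
    intro j
    have := h.measure_increment_eq (hτ j.le_succ) (j % 2)
    refine this.trans ?_
    have hf : (j % 2).factorial = 1 := by
      rcases Nat.mod_two_eq_zero_or_one j with e | e <;> simp [e]
    rw [hf]
    congr 1
    rw [show -((lam : ℝ) * ((τ j.succ : ℝ) - τ j)) = lam * τ j - lam * τ (j + 1) by ring]
    simp
  have hd : ∀ j, 0 ≤ (τ (j + 1) : ℝ) - τ j := fun j => by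
    have := hτ j.le_succ
    exact sub_nonneg.2 (by exact_mod_cast this)
  simp only [hp]
  rw [← ENNReal.ofReal_prod_of_nonneg]
  · congr 1
    rw [Finset.prod_mul_distrib, ← Real.exp_sum, Finset.sum_range_sub', h0,
      Finset.prod_range_succ, prod_range_two_mul]
    have e : ∀ i : ℕ, (2 * i + 1) % 2 = 1 := fun i => by omega
    simp [e, Finset.prod_mul_distrib, mul_assoc]
  · intro j _
    have := hd j
    positivity

end Law

section Law

variable {Ω : Type*} [MeasurableSpace Ω] {μ : Measure Ω} {c₁ c₂ : ℝ}
  {lam : ℝ≥0} {V₀ : Ω → ℝ} {N : ℝ≥0 → Ω → ℕ}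

/-- Both sides say that `f (τ j) = j / 2` for all `j ≤ 2n + 1`. The half-open intervals match the
equivalence in `jumpTime_le_iff`. -/
theorem jumpTime_mem_Ioc_iff_increments {f : ℝ≥0 → ℕ} (hf : Monotone f)
    (hc : ∀ s, ContinuousWithinAt f (Ici s) s) (hf0 : f 0 = 0) {n : ℕ} {t : ℝ≥0} {τ : ℕ → ℝ≥0}
    (hτ : Monotone τ) (h0 : τ 0 = 0) (ht : τ (2 * n + 1) = t) :
    (f t = n ∧ ∀ i : Fin n, jumpTime f t i ∈ Ioc (τ (2 * i + 1) : ℝ) (τ (2 * i + 2))) ↔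
      ∀ j ∈ Finset.range (2 * n + 1), f (τ (j + 1)) - f (τ j) = j % 2 := by
  have hmem : ∀ j ≤ 2 * n + 1, (τ j : ℝ) ∈ Icc (0 : ℝ) t := fun j hj =>
    ⟨(τ j).2, by rw [← ht]; exact_mod_cast hτ hj⟩
  have hfτ : Monotone fun j => f (τ j) := hf.comp hτ
  have hjump : f t = n → ∀ i : Fin n, (jumpTime f t i ∈
      Ioc (τ (2 * i + 1) : ℝ) (τ (2 * i + 2)) ↔
      f (τ (2 * i + 1)) ≤ i ∧ i + 1 ≤ f (τ (2 * i + 2))) := by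
    intro hn i
    have hi : (i : ℕ) + 1 ≤ f t := by rw [hn]; exact i.2
    have h1 := jumpTime_le_iff hf hc hi (hmem (2 * i + 1) (by omega))
    have h2 := jumpTime_le_iff hf hc hi (hmem (2 * i + 2) (by omega))
    rw [Real.toNNReal_coe] at h1 h2
    rw [mem_Ioc, h2, ← not_le, h1]
    omega
  constructor
  · rintro ⟨hn, hT⟩
    have hT' := fun i => (hjump hn i).1 (hT i)
    have key : ∀ j ≤ 2 * n + 1, f (τ j) = j / 2 := by
      intro j hj
      refine le_antisymm ?_ ?_
      · rcases Nat.even_or_odd' j with ⟨i, rfl | rfl⟩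
        · rcases Nat.lt_or_ge i n with hi | hi
          · have h1 := (hT' ⟨i, hi⟩).1
            have h2 : f (τ (2 * i)) ≤ f (τ (2 * i + 1)) := hfτ (Nat.le_succ _)
            simp only at h1
            omega
          · have h2 : f (τ (2 * i)) ≤ f (τ (2 * n + 1)) := hfτ hj
            rw [ht, hn] at h2
            omega
        · rcases Nat.lt_or_ge i n with hi | hi
          · have h1 := (hT' ⟨i, hi⟩).1
            simp only at h1
            omega
          · have h2 : f (τ (2 * i + 1)) ≤ f (τ (2 * n + 1)) := hfτ hj
            rw [ht, hn] at h2
            omega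
      · rcases Nat.lt_or_ge j 2 with hj2 | hj2
        · rw [Nat.div_eq_of_lt hj2]; exact Nat.zero_le _
        · have h1 := (hT' ⟨j / 2 - 1, by omega⟩).2
          have h2 : f (τ (2 * (j / 2 - 1) + 2)) ≤ f (τ j) := hfτ (by omega)
          simp only at h1
          omega
    intro j hj
    have hj := Finset.mem_range.1 hj
    rw [key j (by omega), key (j + 1) (by omega)]
    omega
  · intro h
    have key : ∀ j ≤ 2 * n + 1, f (τ j) = j / 2 := by
      intro j
      induction j with
      | zero => intro _; simp [h0, hf0]
      | succ j ih =>
        intro hj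
        have h1 := h j (Finset.mem_range.2 (by omega))
        have h2 := ih (by omega)
        have h3 : f (τ j) ≤ f (τ (j + 1)) := hfτ (Nat.le_succ _)
        omega
    have hn : f t = n := by
      rw [← ht, key _ le_rfl]; omega
    refine ⟨hn, fun i => (hjump hn i).2 ?_⟩
    rw [key _ (by omega), key _ (by omega)]
    omega

theorem IsTelegraphInput.measurableSet_init_count (h : IsTelegraphInput c₁ c₂ lam V₀ N μ)
    (t : ℝ≥0) (n : ℕ) : MeasurableSet {ω | V₀ ω = c₁ ∧ N t ω = n} :=
  (h.measurable_init (measurableSet_singleton c₁)).inter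
    (h.poisson.measurable t (measurableSet_singleton n))

theorem IsTelegraphInput.measure_init_count (h : IsTelegraphInput c₁ c₂ lam V₀ N μ) (hc₁ : 0 < c₁)
    (hc₂ : 0 < c₂) (t : ℝ≥0) (n : ℕ) : μ {ω | V₀ ω = c₁ ∧ N t ω = n} =
      2⁻¹ * ENNReal.ofReal (Real.exp (-(lam * t)) * lam ^ n * divPow n t) := by
  have h1 := h.measure_init_inter hc₁ hc₂ (A := {f | f t = n})
    ((measurableSet_singleton n).preimage (measurable_pi_apply t))
  refine h1.trans ?_
  have h2 : μ {ω | (fun t => N t ω) ∈ {f : ℝ≥0 → ℕ | f t = n}} =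
      μ {ω | N t ω - N 0 ω = n} := by
    refine measure_congr ?_
    filter_upwards [h.poisson.start] with ω hω
    refine propext ?_
    change N t ω = n ↔ N t ω - N 0 ω = n
    rw [hω, Nat.sub_zero]
  rw [h2, h.poisson.measure_increment_eq zero_le]
  congr 2
  simp [divPow, mul_pow]
  ring

theorem IsTelegraphInput.measure_jumpTime_box (h : IsTelegraphInput c₁ c₂ lam V₀ N μ)
    (hc₁ : 0 < c₁) (hc₂ : 0 < c₂) {t : ℝ≥0} {n : ℕ} {a b : Fin n → ℝ}
    (hab : Icc a b ⊆ orderedTimes 0 t n) (hle : a ≤ b) :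
    μ ({ω | ∀ i : Fin n, jumpTime (fun s => N s ω) t i ∈ Ioc (a i) (b i)} ∩
      {ω | V₀ ω = c₁ ∧ N t ω = n}) =
      2⁻¹ * ENNReal.ofReal (Real.exp (-(lam * t)) * lam ^ n) *
        volume (univ.pi fun i => Ioc (a i) (b i)) := by
  obtain ⟨τ, hτ, h0, ht, hi⟩ := exists_monotone_interlacing hab hle
  have hA : MeasurableSet
      {f : ℝ≥0 → ℕ | ∀ j ∈ Finset.range (2 * n + 1), f (τ (j + 1)) - f (τ j) = j % 2} := by
    have : {f : ℝ≥0 → ℕ | ∀ j ∈ Finset.range (2 * n + 1), f (τ (j + 1)) - f (τ j) = j % 2} =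
        ⋂ j ∈ Finset.range (2 * n + 1),
          (fun f : ℝ≥0 → ℕ => f (τ (j + 1)) - f (τ j)) ⁻¹' {j % 2} := by
      ext f; simp
    rw [this]
    exact Finset.measurableSet_biInter _ fun j _ =>
      (measurableSet_singleton _).preimage
        ((measurable_pi_apply (τ (j + 1))).sub (measurable_pi_apply (τ j)))
  have h1 := h.measure_init_inter hc₁ hc₂ hA
  have h2 := h.poisson.measure_alternating n hτ h0
  have h3 : μ ({ω | ∀ i : Fin n, jumpTime (fun s => N s ω) t i ∈ Ioc (a i) (b i)} ∩
      {ω | V₀ ω = c₁ ∧ N t ω = n}) = μ ({ω | V₀ ω = c₁} ∩ {ω | (fun t => N t ω) ∈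
        {f : ℝ≥0 → ℕ | ∀ j ∈ Finset.range (2 * n + 1), f (τ (j + 1)) - f (τ j) = j % 2}}) := by
    refine measure_congr ?_
    filter_upwards [h.poisson.start, h.poisson.monotone, h.poisson.rightContinuous]
      with ω hω0 hωm hωc
    refine propext ?_
    have key := jumpTime_mem_Ioc_iff_increments hωm hωc hω0 hτ h0 ht
    simp only [(hi _).1, (hi _).2] at key
    change (_ ∧ _ ∧ _) ↔ (_ ∧ _)
    exact ⟨fun ⟨x, y, z⟩ => ⟨y, key.1 ⟨z, x⟩⟩, fun ⟨y, x⟩ => ⟨(key.2 x).2, y, (key.2 x).1⟩⟩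
  rw [h3, h1, mul_assoc]
  congr 1
  refine h2.trans ?_
  rw [ht, ENNReal.ofReal_mul (by positivity), Real.volume_pi_Ioc,
    ← ENNReal.ofReal_prod_of_nonneg fun i _ => sub_nonneg.2 (hle i),
    ← Fin.prod_univ_eq_prod_range (fun i => (τ (2 * i + 2) : ℝ) - τ (2 * i + 1))]
  simp only [(hi _).1, (hi _).2]

/-- Boxes identify the two measures inside the simplex; a comparison of total masses excludes the
rest. -/
theorem IsTelegraphInput.map_jumpTime [IsProbabilityMeasure μ]
    (h : IsTelegraphInput c₁ c₂ lam V₀ N μ) (hc₁ : 0 < c₁) (hc₂ : 0 < c₂) {t : ℝ≥0} (ht : 0 < t)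
    (n : ℕ) :
    (μ.restrict {ω | V₀ ω = c₁ ∧ N t ω = n}).map
        (fun ω (i : Fin n) => jumpTime (fun s => N s ω) t i) =
      (2⁻¹ * ENNReal.ofReal (Real.exp (-(lam * t)) * lam ^ n)) •
        volume.restrict (orderedTimes 0 t n) := by
  set E := {ω | V₀ ω = c₁ ∧ N t ω = n}
  set C : ℝ≥0∞ := 2⁻¹ * ENNReal.ofReal (Real.exp (-(lam * t)) * lam ^ n)
  have hT : Measurable fun ω (i : Fin n) => jumpTime (fun s => N s ω) t i :=
    measurable_pi_lambda _ fun i => measurable_jumpTime h.poisson.measurable t i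
  set ν := (μ.restrict E).map fun ω (i : Fin n) => jumpTime (fun s => N s ω) t i
  have hO := isOpen_orderedTimes 0 t n
  have hOm := hO.measurableSet
  have hrestr : ν.restrict (orderedTimes 0 t n) = C • volume.restrict (orderedTimes 0 t n) := by
    refine measure_ext_of_boxes hO ?_ ?_ fun a b hab hle => ?_
    · rw [Measure.restrict_apply hOm.compl, compl_inter_self, measure_empty]
    · rw [Measure.smul_apply, Measure.restrict_apply hOm.compl, compl_inter_self, measure_empty,
        smul_zero]
    · have hbm : MeasurableSet (univ.pi fun i => Ioc (a i) (b i)) :=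
        MeasurableSet.univ_pi fun _ => measurableSet_Ioc
      have hsub : (univ.pi fun i => Ioc (a i) (b i)) ⊆ orderedTimes 0 t n :=
        fun x hx => hab ⟨fun i => (hx i trivial).1.le, fun i => (hx i trivial).2⟩
      rw [Measure.smul_apply, Measure.restrict_apply hbm, Measure.restrict_apply hbm,
        inter_eq_left.2 hsub, Measure.map_apply hT hbm, Measure.restrict_apply (hT hbm),
        smul_eq_mul, ← h.measure_jumpTime_box hc₁ hc₂ hab hle]
      congr 2
      ext ω
      simp
  -- The volume `t ^ n / n!` of the simplex already accounts for the whole Poisson mass, so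
  -- coinciding jumps, or jumps at the ends, have probability zero.
  have hcompl : ν (orderedTimes 0 t n)ᶜ = 0 := by
    have h1 : ν univ = ν (orderedTimes 0 t n) := by
      have h2 := congrArg (fun m => m (orderedTimes 0 (t : ℝ) n)) hrestr
      simp only [Measure.restrict_apply_self, Measure.smul_apply, smul_eq_mul] at h2
      have ht' : (0 : ℝ) < t := ht
      rw [h2, volume_orderedTimes ht', Measure.map_apply hT MeasurableSet.univ, preimage_univ,
        Measure.restrict_apply_univ, h.measure_init_count hc₁ hc₂, sub_zero,
        ENNReal.ofReal_mul (by positivity), mul_assoc]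
    rw [measure_compl hOm (measure_ne_top _ _), h1, tsub_self]
  rw [← hrestr, Measure.restrict_eq_self_of_ae_mem]
  exact measure_eq_zero_iff_ae_notMem.1 hcompl |>.mono fun x hx => not_not.1 hx

theorem measure_telegraphMax_lt_inter [IsProbabilityMeasure μ]
    (h : IsTelegraphInput c₁ c₂ lam V₀ N μ) (hc₁ : 0 < c₁) (hc₂ : 0 < c₂) {t : ℝ≥0} (ht : 0 < t)
    (n : ℕ) {β : ℝ} (hβ : 0 < β) :
    μ ({ω | V₀ ω = c₁ ∧ N t ω = n} ∩ {ω | telegraphMax c₁ c₂ V₀ N t ω < β}) =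
      2⁻¹ * ENNReal.ofReal (Real.exp (-(lam * t)) * lam ^ n) *
        volume {u : Fin n → ℝ | StaysBelow t β c₁ (-c₂) n 0 0 u} := by
  have hT : Measurable fun ω (i : Fin n) => jumpTime (fun s => N s ω) t i :=
    measurable_pi_lambda _ fun i => measurable_jumpTime h.poisson.measurable t i
  have hE := h.measurableSet_init_count t n
  have hB := measurableSet_staysBelow t β c₁ (-c₂) n 0 0
  have hsub : {u : Fin n → ℝ | StaysBelow t β c₁ (-c₂) n 0 0 u} ⊆ orderedTimes 0 t n :=
    fun u hu => StaysBelow.mem_orderedTimes hu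
  have hmap := h.map_jumpTime hc₁ hc₂ ht n
  have hae : ∀ᵐ ω ∂μ, ω ∈ {ω | V₀ ω = c₁ ∧ N t ω = n} →
      (fun i : Fin n => jumpTime (fun s => N s ω) t i) ∈ orderedTimes 0 t n := by
    rw [← ae_restrict_iff' hE]
    refine ae_of_ae_map hT.aemeasurable (p := fun u => u ∈ orderedTimes 0 t n) ?_
    rw [hmap]
    exact Measure.ae_smul_measure (ae_restrict_mem (isOpen_orderedTimes 0 t n).measurableSet) _
  have h1 := congrArg (fun m => m {u : Fin n → ℝ | StaysBelow t β c₁ (-c₂) n 0 0 u}) hmap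
  rw [Measure.map_apply hT hB, Measure.restrict_apply (hT hB), Measure.smul_apply,
    Measure.restrict_apply hB, smul_eq_mul,
    inter_eq_left.2 hsub] at h1
  rw [← h1, inter_comm]
  refine measure_congr ?_
  filter_upwards [hae, h.poisson.monotone, h.poisson.rightContinuous] with ω hω hωm hωc
  refine propext ?_
  change (_ ∧ _ ∧ _) ↔ (_ ∧ _ ∧ _)
  refine and_congr_left fun hE => ?_
  exact telegraphMax_lt_iff_staysBelow hβ hE.1 hωm hωc hE.2 (hω hE)

end Law

/-! ### The conditional probability -/

theorem zero_le_telegraphMax {Ω : Type*} (c₁ c₂ : ℝ) {V₀ : Ω → ℝ} {N : ℝ≥0 → Ω → ℕ}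
    (t : ℝ≥0) {ω : Ω} (hN : Monotone fun s => N s ω) :
    0 ≤ telegraphMax c₁ c₂ V₀ N t ω :=
  (isGreatest_telegraphMax c₁ c₂ V₀ N t ω hN).2 ⟨0, ⟨le_rfl, zero_le⟩, by simp [telegraph]⟩

theorem upVol_div (r c : ℝ) (k : ℕ) (x y : ℝ) :
    (2 * k).factorial * upVol r k (x / c) (y / c) = 1 / c ^ (2 * k) *
      ∑ j ∈ Finset.range k, (Nat.choose (2 * k) j : ℝ) *
        (x ^ j * y ^ (2 * k - j) - r ^ (2 * k - 2 * j) * (x ^ (2 * k - j) * y ^ j)) := by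
  rw [upVol, Finset.mul_sum, Finset.mul_sum]
  refine Finset.sum_congr rfl fun j hj => ?_
  have hj : j ≤ 2 * k := by have := Finset.mem_range.1 hj; omega
  have h1 : c ^ (2 * k) = c ^ j * c ^ (2 * k - j) := by rw [← pow_add]; congr 1; omega
  have h2 := Nat.factorial_ne_zero j
  have h3 := Nat.factorial_ne_zero (2 * k - j)
  rw [Nat.cast_choose ℝ hj, h1]
  simp only [divPow, div_eq_mul_inv, mul_inv]
  ring

theorem theorem2p1 {Ω : Type*} [MeasurableSpace Ω] (μ : Measure Ω) [IsProbabilityMeasure μ]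
    (c₁ c₂ : ℝ) (hc₁ : 0 < c₁) (hc₂ : 0 < c₂) (lam : ℝ≥0) (hlam : 0 < lam)
    (V₀ : Ω → ℝ) (N : ℝ≥0 → Ω → ℕ) (h : IsTelegraphInput c₁ c₂ lam V₀ N μ)
    (t : ℝ≥0) (ht : 0 < t) (k : ℕ) (hk : 1 ≤ k) (β : ℝ) (hβ : β ∈ Icc 0 (c₁ * (t : ℝ))) :
    (μ[{ω | telegraphMax c₁ c₂ V₀ N t ω < β} | {ω | V₀ ω = c₁ ∧ N t ω = 2 * k}]).toReal =
      1 / ((c₁ + c₂) * (t : ℝ)) ^ (2 * k) *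
        ∑ j ∈ Finset.range k, (Nat.choose (2 * k) j : ℝ) *
          ((c₁ * (t : ℝ) - β) ^ j * (c₂ * (t : ℝ) + β) ^ (2 * k - j)
            - (c₂ / c₁) ^ (2 * k - 2 * j) *
              ((c₁ * (t : ℝ) - β) ^ (2 * k - j) * (c₂ * (t : ℝ) + β) ^ j)) := by
  have ht' : (0 : ℝ) < t := ht
  have hlam' : (0 : ℝ) < lam := hlam
  have hc : 0 < c₁ + c₂ := add_pos hc₁ hc₂
  rw [← upVol_div, cond_apply (h.measurableSet_init_count t (2 * k))]
  set x := c₁ * (t : ℝ) - β with hx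
  set y := c₂ * (t : ℝ) + β with hy
  have hx0 : 0 ≤ x := sub_nonneg.2 hβ.2
  -- Homogeneity of degree `2k`.
  have hscale : upVol (c₂ / c₁) k (x / ((c₁ + c₂) * t)) (y / ((c₁ + c₂) * t)) =
      upVol (c₂ / c₁) k (x / (c₁ + c₂)) (y / (c₁ + c₂)) / t ^ (2 * k) := by
    have hne := (Nat.cast_ne_zero (R := ℝ)).2 (Nat.factorial_ne_zero (2 * k))
    refine mul_left_cancel₀ hne ?_
    rw [mul_div_assoc', upVol_div, upVol_div, mul_pow]
    field_simp
  -- At `β = 0` the volume computation, which needs a start strictly below the level, does not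
  -- apply: the maximum is almost surely nonnegative, and the formula vanishes on `y = r x`.
  rcases hβ.1.eq_or_lt with rfl | hβ0
  · have hempty : μ ({ω | V₀ ω = c₁ ∧ N t ω = 2 * k} ∩
        {ω | telegraphMax c₁ c₂ V₀ N t ω < 0}) = 0 := by
      refine measure_eq_zero_iff_ae_notMem.2 ?_
      filter_upwards [h.poisson.monotone] with ω hω hmem
      exact absurd hmem.2 (not_lt.2 (zero_le_telegraphMax c₁ c₂ t hω))
    have hd : y / ((c₁ + c₂) * t) = c₂ / c₁ * (x / ((c₁ + c₂) * t)) := by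
      rw [hx, hy]; field_simp; ring
    rw [hempty, hd, upVol_diag]
    simp
  · have hvol := volume_staysBelow_up hc₁ hc₂ k (t := t) 0 0 ht' hβ0 (by simpa using hβ.2)
    simp only [sub_zero] at hvol
    have hup : 0 ≤ upVol (c₂ / c₁) k (x / (c₁ + c₂)) (y / (c₁ + c₂)) := by
      refine upVol_nonneg (div_pos hc₂ hc₁).le (div_nonneg hx0 hc.le) ?_ k
      have : y / (c₁ + c₂) - c₂ / c₁ * (x / (c₁ + c₂)) = β / c₁ := by
        rw [hx, hy]; field_simp; ring
      have := div_pos hβ0 hc₁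
      linarith
    rw [measure_telegraphMax_lt_inter h hc₁ hc₂ ht (2 * k) hβ0, h.measure_init_count hc₁ hc₂, hvol,
      hscale]
    simp only [ENNReal.toReal_mul, ENNReal.toReal_inv]
    rw [ENNReal.toReal_ofReal hup,
      ENNReal.toReal_ofReal (r := Real.exp (-(lam * t)) * lam ^ (2 * k)) (by positivity),
      ENNReal.toReal_ofReal (mul_nonneg (by positivity) (divPow_nonneg ht'.le)), divPow]
    have := Nat.factorial_ne_zero (2 * k)
    simp only [ENNReal.toReal_ofNat]
    field_simp
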